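/- Let $X=(X_t)_{t\ge 0}$ be a real-valued process and let $\mathbb P_{-1},\mathbb P_1$ be probability measures such that, under $\mathbb P_\theta$ ($\theta\in\{-1,1\}$), $X_t=\theta t+W_t$ with $W$ a standard Brownian motion, $W_0=0$. Let $\Phi$ be the standard normal distribution function. For $(\alpha,\beta)\in(0,\tfrac12)^2$ let $T_{\alpha,\beta}$ be the smallest deterministic time $T\ge 0$ for which there is a decision rule $d\in\{-1,1\}$, measurable with respect to $\sigma(X_s: s\le T)$, with $$\mathbb P_{-1}(d=1)\le\alpha\quad\text{and}\quad \mathbb P_1(d=-1)\le\beta ,$$ and let $$\tau_{\alpha,\beta}=\inf\Big\{t\ge 0: X_t\notin\Big(\tfrac12\ln\tfrac{\beta}{1-\alpha},\ \tfrac12\ln\tfrac{1-\beta}{\alpha}\Big)\Big\}$$ be the stopping time of the sequential probability ratio test (SPRT) with error probabilities $\alpha$ and $\beta$. Set $$F(\alpha,\beta)=\frac{\max\{\mathbb E_{-1}[\tau_{\alpha,\beta}],\ \mathbb E_{1}[\tau_{\alpha,\beta}]\}}{T_{\alpha,\beta}},\qquad f(\alpha)=\frac{\mathbb E_1[\tau_{\alpha,\alpha}]}{T_{\alpha,\alpha}}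 .$$ Then for all $(\alpha,\beta)\in(0,\tfrac12)^2$ the time $T_{\alpha,\beta}$ exists and equals $\big(\Phi^{-1}(\alpha)+\Phi^{-1}(\beta)\big)^2/4$, both expectations are finite, and, with $m=\min\{\alpha,\beta\}$, $$F(\alpha,\beta)\ \ge\ f(m)=\frac{\tfrac{1-2m}{2}\ln\frac{1-m}{m}}{\big(\Phi^{-1}(m)\big)^2}.$$ In particular $F(\alpha,\beta)\ge\tfrac14$, so the reduction $1-F(\alpha,\beta)$ of the average sample size never exceeds $75\%$. -/

import Mathlib

open MeasureTheory ProbabilityTheory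
open scoped NNReal ENNReal

namespace SPRT

noncomputable section

/-- The standard normal distribution function `Φ`. -/
def Phi (x : ℝ) : ℝ := cdf (gaussianReal 0 1) x

/-- The standard normal quantile function `Φ⁻¹`. As `Φ` is a continuous, strictly increasing
bijection from `ℝ` onto `(0, 1)`, this is its inverse on `(0, 1)`. -/
def PhiInv (p : ℝ) : ℝ := sInf {x : ℝ | p ≤ Phi x}

/-- Under the probability measure `P`, the measurable process `X` is `X t = θ t + W t` with `W` a
standard Brownian motion started at `0`. -/
structure IsBrownianWithDrift {Ω : Type*} [MeasurableSpace Ω]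
    (X : ℝ≥0 → Ω → ℝ) (θ : ℝ) (P : Measure Ω) : Prop where
  measurable : ∀ t, Measurable (X t)
  brownian : IsBrownianReal (fun t ω ↦ X t ω - θ * (t : ℝ)) P

/-- The σ-algebra generated by the observations `X s`, `s ≤ T`. -/
abbrev observed {Ω : Type*} (X : ℝ≥0 → Ω → ℝ) (T : ℝ≥0) : MeasurableSpace Ω :=
  ⨆ s ≤ T, MeasurableSpace.comap (X s) inferInstance

/-- `d` is a decision rule with values in `{-1, 1}` based on the observation of `X` on `[0, T]`,
with error probabilities `P₋₁(d = 1) ≤ α` and `P₁(d = -1) ≤ β`. Here `Pneg` is the measure under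
the hypothesis `θ = -1`, and `Ppos` the one under `θ = 1`. -/
structure IsFixedSizeTest {Ω : Type*} [MeasurableSpace Ω] (X : ℝ≥0 → Ω → ℝ)
    (Pneg Ppos : Measure Ω) (α β : ℝ) (T : ℝ≥0) (d : Ω → ℤ) : Prop where
  measurable : Measurable[observed X T] d
  values : ∀ ω, d ω = -1 ∨ d ω = 1
  error_neg : Pneg {ω | d ω = 1} ≤ ENNReal.ofReal α
  error_pos : Ppos {ω | d ω = -1} ≤ ENNReal.ofReal β

/-- The deterministic sample sizes for which a test with error bounds `α` and `β` exists. -/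
def fixedSampleSizes {Ω : Type*} [MeasurableSpace Ω] (X : ℝ≥0 → Ω → ℝ)
    (Pneg Ppos : Measure Ω) (α β : ℝ) : Set ℝ≥0 :=
  {T | ∃ d : Ω → ℤ, IsFixedSizeTest X Pneg Ppos α β T d}

/-- The minimal fixed sample size `T_{α,β}`. -/
def minFixedSampleSize {Ω : Type*} [MeasurableSpace Ω] (X : ℝ≥0 → Ω → ℝ)
    (Pneg Ppos : Measure Ω) (α β : ℝ) : ℝ≥0 :=
  sInf (fixedSampleSizes X Pneg Ppos α β)

/-- The stopping time `τ_{α,β}` of the sequential probability ratio test: the first time at which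
`X` is outside of the interval `(½ log (β / (1 - α)), ½ log ((1 - β) / α))`, and `∞` if there is
no such time. -/
def sprtTime {Ω : Type*} (X : ℝ≥0 → Ω → ℝ) (α β : ℝ) : Ω → ℝ≥0∞ :=
  hittingAfter X
    (Set.Ioo (1 / 2 * Real.log (β / (1 - α))) (1 / 2 * Real.log ((1 - β) / α)))ᶜ 0

/-- The expectation, in `[0, ∞]`, of `τ_{α,β}` under `P`. -/
def sprtMean {Ω : Type*} [MeasurableSpace Ω] (X : ℝ≥0 → Ω → ℝ) (P : Measure Ω) (α β : ℝ) : ℝ≥0∞ :=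
  ∫⁻ ω, sprtTime X α β ω ∂P

/-- The relative efficiency
`F(α, β) = max {E₋₁[τ_{α,β}], E₁[τ_{α,β}]} / T_{α,β}`. -/
def relEff {Ω : Type*} [MeasurableSpace Ω] (X : ℝ≥0 → Ω → ℝ)
    (Pneg Ppos : Measure Ω) (α β : ℝ) : ℝ :=
  max (sprtMean X Pneg α β).toReal (sprtMean X Ppos α β).toReal /
    (minFixedSampleSize X Pneg Ppos α β : ℝ)

/-- The relative efficiency `f(α) = E₁[τ_{α,α}] / T_{α,α}` for equal error bounds. -/
def symmRelEff {Ω : Type*} [MeasurableSpace Ω] (X : ℝ≥0 → Ω → ℝ)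
    (Pneg Ppos : Measure Ω) (α : ℝ) : ℝ :=
  (sprtMean X Ppos α α).toReal / (minFixedSampleSize X Pneg Ppos α α : ℝ)

end

end SPRT

/-!
The proof computes both sides of the comparison in closed form and then compares them.

*Fixed sample size.* Under either hypothesis the bridge of `X` on `[0, T]` is independent of `X T`,
and its law does not depend on the drift. So `X T` is sufficient, and the likelihood ratio on the
observations up to `T` is `exp (2 X T)` (`measure_eq_lintegral_exp`). By the Neyman–Pearson lemma
(`measure_le_of_measure_le`) it suffices to consider the tests `X T > c`, whose error probabilities
are values of `Φ`; this gives the minimal sample size (`isLeast_fixedSampleSizes`).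

*Sequential test.* For the drift `1`, the function `v x = c₁ - x + c₂ exp (-2 x)` makes
`v (X t) + t` a martingale. With `v` vanishing at both ends of the interval, optional stopping
(`integral_stopped_eq`) at the exit time capped at `n`, followed by `n → ∞`, shows that the mean
exit time is `v 0` (`lintegral_exitTime`), which is `exitMean α β`. The drift `-1` reduces to the
drift `1` by reflection.

*Comparison.* Let `α ≤ β`, `x = -Φ⁻¹ α`, `y = -Φ⁻¹ β`, `z = 2 Φ x - 1`, `w = 2 Φ y - 1` and
`r = y / x`. Then `2 * exitMean α β = w artanh z + negEntropy w - log (1 - z ^ 2) / 2` increases in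
`w`, and `w ≥ r z` by concavity of `Φ` on `[0, ∞)`. So the comparison with the symmetric case
reduces to an inequality in `r` and `z`, which holds for each coefficient of the power series in `z`
by Bernoulli's inequality (`one_add_sq_mul_artanh_le`). The lower bound `1 / 4` follows from
`2 z artanh z ≥ -log (1 - z ^ 2)` and `1 - z ^ 2 ≤ exp (-x ^ 2 / 2)`.
-/

namespace SPRT

open Filter Topology Set

/-! ### The standard normal distribution function -/

theorem hasDerivAt_Phi (x : ℝ) : HasDerivAt Phi (gaussianPDFReal 0 1 x) x := by
  have hint := integrable_gaussianPDFReal 0 1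
  have hcont : Continuous (gaussianPDFReal 0 1) := by
    unfold gaussianPDFReal; fun_prop
  have h : Phi = fun y ↦ (∫ t in Iic (0 : ℝ), gaussianPDFReal 0 1 t)
      + ∫ t in (0 : ℝ)..y, gaussianPDFReal 0 1 t := by
    funext y
    rw [← intervalIntegral.integral_Iic_sub_Iic hint.integrableOn hint.integrableOn, add_sub_cancel,
      Phi, cdf_eq_real, measureReal_def, gaussianReal_apply_eq_integral _ one_ne_zero,
      ENNReal.toReal_ofReal (integral_nonneg fun _ ↦ gaussianPDFReal_nonneg _ _ _)]
  rw [h]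
  exact (intervalIntegral.integral_hasDerivAt_right (hcont.intervalIntegrable _ _)
    (hcont.stronglyMeasurableAtFilter _ _) hcont.continuousAt).const_add _

theorem continuous_Phi : Continuous Phi :=
  continuous_iff_continuousAt.2 fun x ↦ (hasDerivAt_Phi x).continuousAt

theorem strictMono_Phi : StrictMono Phi :=
  strictMono_of_hasDerivAt_pos hasDerivAt_Phi fun _ ↦ gaussianPDFReal_pos _ _ _ one_ne_zero

theorem gaussianReal_Iic_eq_ofReal_Phi (μ : ℝ) {v : ℝ≥0} (hv : v ≠ 0) (c : ℝ) :
    gaussianReal μ v (Iic c) = ENNReal.ofReal (Phi ((c - μ) / √v)) := by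
  have hs : 0 < √(v : ℝ) := Real.sqrt_pos.2 (by positivity)
  have h : gaussianReal μ v = ((gaussianReal 0 1).map (√(v : ℝ) * ·)).map (μ + ·) := by
    rw [gaussianReal_map_const_mul, gaussianReal_map_const_add]
    congr 1
    · simp
    · ext; simp
  rw [Phi, ofReal_cdf, h, Measure.map_apply (by fun_prop) measurableSet_Iic,
    Measure.map_apply (by fun_prop) ((measurable_const_add μ) measurableSet_Iic)]
  congr 1
  ext x
  simp only [mem_preimage, mem_Iic, le_div_iff₀ hs]
  constructor <;> intro h <;> linarith

theorem Phi_neg (x : ℝ) : Phi (-x) = 1 - Phi x := by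
  have := nullSingletonClass_gaussianReal (μ := 0) (one_ne_zero : (1 : ℝ≥0) ≠ 0)
  have h : (gaussianReal 0 1).real (Iic (-x)) = (gaussianReal 0 1).real (Ioi x) := by
    have h1 : (gaussianReal 0 1).map (fun x ↦ -x) = gaussianReal 0 1 := by
      simp [gaussianReal_map_neg]
    conv_lhs => rw [← h1]
    rw [measureReal_def, Measure.map_apply measurable_neg measurableSet_Iic, ← measureReal_def]
    rw [measureReal_congr (Ioi_ae_eq_Ici (a := x))]
    congr 1
    ext y
    simp
  rw [Phi, Phi, cdf_eq_real, cdf_eq_real, h, ← compl_Iic,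
    probReal_compl_eq_one_sub measurableSet_Iic]

theorem Phi_zero : Phi 0 = 1 / 2 := by
  have := Phi_neg 0
  rw [neg_zero] at this
  linarith

theorem Phi_PhiInv {p : ℝ} (hp : p ∈ Ioo (0 : ℝ) 1) : Phi (PhiInv p) = p := by
  obtain ⟨x, rfl⟩ : ∃ x, Phi x = p := by
    obtain ⟨a, ha⟩ := ((tendsto_cdf_atBot (gaussianReal 0 1)).eventually_lt_const hp.1).exists
    obtain ⟨b, hb⟩ := ((tendsto_cdf_atTop (gaussianReal 0 1)).eventually_const_lt hp.2).exists
    exact mem_range_of_exists_le_of_exists_ge continuous_Phi ⟨a, ha.le⟩ ⟨b, hb.le⟩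
  have : {y : ℝ | Phi x ≤ Phi y} = Ici x := by
    ext y; simp [strictMono_Phi.le_iff_le]
  rw [PhiInv, this, csInf_Ici]

theorem PhiInv_neg {p : ℝ} (hp : p ∈ Ioo (0 : ℝ) (1 / 2)) : PhiInv p < 0 := by
  rw [← strictMono_Phi.lt_iff_lt, Phi_PhiInv ⟨hp.1, by linarith [hp.2]⟩, Phi_zero]
  exact hp.2

theorem gaussianPDFReal_zero_one (x : ℝ) :
    gaussianPDFReal 0 1 x = (√(2 * Real.pi))⁻¹ * Real.exp (-x ^ 2 / 2) := by
  simp [gaussianPDFReal]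

/-- `Φ` is concave on `[0, ∞)`, so the slope of `2 Φ - 1`, which vanishes at `0`, decreases. -/
theorem mul_two_Phi_sub_one_le {x y : ℝ} (hy : 0 ≤ y) (hyx : y ≤ x) :
    y * (2 * Phi x - 1) ≤ x * (2 * Phi y - 1) := by
  have hc : ConcaveOn ℝ (Ici 0) Phi := by
    refine AntitoneOn.concaveOn_of_deriv (convex_Ici 0) continuous_Phi.continuousOn
      (fun x _ ↦ (hasDerivAt_Phi x).differentiableAt.differentiableWithinAt) ?_
    intro u hu v hv huv
    rw [interior_Ici, mem_Ioi] at hu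
    rw [(hasDerivAt_Phi u).deriv, (hasDerivAt_Phi v).deriv, gaussianPDFReal_zero_one,
      gaussianPDFReal_zero_one]
    gcongr
  rcases hy.eq_or_lt with rfl | hy
  · simp [Phi_zero]
  have hx : 0 < x := hy.trans_le hyx
  have h := hc.2 (mem_Ici.2 hx.le) (mem_Ici.2 le_rfl) (by positivity : 0 ≤ y / x)
    (by rw [sub_nonneg, div_le_one hx]; exact hyx : 0 ≤ 1 - y / x) (by ring)
  simp only [smul_eq_mul, mul_zero, add_zero, Phi_zero, div_mul_cancel₀ _ hx.ne'] at h
  have h2 := mul_le_mul_of_nonneg_left h hx.le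
  have h3 : x * (y / x * Phi x + (1 - y / x) * (1 / 2)) = y * Phi x + (x - y) / 2 := by
    field_simp
  linarith

theorem two_Phi_sub_one_pos {x : ℝ} (hx : 0 < x) : 0 < 2 * Phi x - 1 := by
  have := strictMono_Phi hx
  rw [Phi_zero] at this
  linarith

theorem Phi_pos (x : ℝ) : 0 < Phi x :=
  (cdf_nonneg (gaussianReal 0 1) (x - 1)).trans_lt (strictMono_Phi (sub_one_lt x))

theorem Phi_lt_one (x : ℝ) : Phi x < 1 :=
  (strictMono_Phi (lt_add_one x)).trans_le (cdf_le_one (gaussianReal 0 1) (x + 1))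

/-- In terms of two independent standard normal variables, the square `[-x, x]²` contains the disc
of radius `x`. The proof studies the sign of the derivative of the difference instead: it is
positive up to some point and negative from there on, and the difference vanishes at `0` and at
`∞`. -/
theorem one_sub_sq_two_Phi_sub_one_le {x : ℝ} (hx : 0 ≤ x) :
    1 - (2 * Phi x - 1) ^ 2 ≤ Real.exp (-x ^ 2 / 2) := by
  set Ψ : ℝ → ℝ := fun t ↦ (2 * Phi t - 1) ^ 2 - 1 + Real.exp (-t ^ 2 / 2) with hΨ
  have hφ (t : ℝ) : Real.exp (-t ^ 2 / 2) = √(2 * Real.pi) * gaussianPDFReal 0 1 t := by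
    rw [gaussianPDFReal_zero_one, mul_inv_cancel_left₀ (by positivity)]
  have hd (t : ℝ) : HasDerivAt Ψ
      (gaussianPDFReal 0 1 t * (4 * (2 * Phi t - 1) - √(2 * Real.pi) * t)) t := by
    have h1 := ((((hasDerivAt_Phi t).const_mul 2).sub_const 1).pow 2).sub_const 1
    have h2 : HasDerivAt (fun t : ℝ ↦ Real.exp (-t ^ 2 / 2)) (Real.exp (-t ^ 2 / 2) * (-t)) t := by
      have := ((((hasDerivAt_id t).pow 2).neg).div_const 2).exp
      refine this.congr_deriv ?_
      simp; ring
    refine (h1.add h2).congr_deriv ?_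
    rw [hφ]
    push_cast
    ring
  have hdiff : Differentiable ℝ Ψ := fun t ↦ (hd t).differentiableAt
  suffices 0 ≤ Ψ x by simp only [hΨ] at this; linarith
  rcases hx.eq_or_lt with rfl | hx
  · simp [hΨ, Phi_zero]
  by_cases hsign : √(2 * Real.pi) * x ≤ 4 * (2 * Phi x - 1)
  · have hmono : MonotoneOn Ψ (Icc 0 x) := by
      refine monotoneOn_of_deriv_nonneg (convex_Icc 0 x) hdiff.continuous.continuousOn
        hdiff.differentiableOn fun t ht ↦ ?_
      rw [interior_Icc] at ht
      rw [(hd t).deriv]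
      refine mul_nonneg (gaussianPDFReal_nonneg _ _ _) (sub_nonneg.2 ?_)
      refine le_of_mul_le_mul_left ?_ hx
      have := mul_two_Phi_sub_one_le ht.1.le ht.2.le
      nlinarith [mul_le_mul_of_nonneg_left hsign ht.1.le]
    have := hmono (left_mem_Icc.2 hx.le) (right_mem_Icc.2 hx.le) hx.le
    simpa [hΨ, Phi_zero] using this
  · push Not at hsign
    have hanti : AntitoneOn Ψ (Ici x) := by
      refine antitoneOn_of_deriv_nonpos (convex_Ici x) hdiff.continuous.continuousOn
        hdiff.differentiableOn fun t ht ↦ ?_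
      rw [interior_Ici, mem_Ioi] at ht
      rw [(hd t).deriv]
      refine mul_nonpos_of_nonneg_of_nonpos (gaussianPDFReal_nonneg _ _ _) (sub_nonpos.2 ?_)
      refine le_of_mul_le_mul_left ?_ hx
      have := mul_two_Phi_sub_one_le hx.le ht.le
      nlinarith [mul_le_mul_of_nonneg_left hsign.le (hx.trans ht).le]
    have hlim : Tendsto Ψ atTop (𝓝 ((2 * 1 - 1) ^ 2 - 1 + 0)) := by
      refine ((((tendsto_cdf_atTop (gaussianReal 0 1)).const_mul 2).sub_const 1).pow 2
        |>.sub_const 1).add ?_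
      refine Real.tendsto_exp_atBot.comp ?_
      simp_rw [neg_div]
      exact tendsto_neg_atTop_atBot.comp
        ((tendsto_pow_atTop two_ne_zero).atTop_div_const two_pos)
    rw [show ((2 * 1 - 1) ^ 2 - 1 + 0 : ℝ) = 0 by norm_num] at hlim
    exact le_of_tendsto hlim ((eventually_ge_atTop x).mono fun t ht ↦
      hanti self_mem_Ici ht ht)

/-! ### Inequalities for the mean sample sizes -/

theorem artanh_eq_half_log_sub_log {z : ℝ} (hz : |z| < 1) :
    Real.artanh z = (Real.log (1 + z) - Real.log (1 - z)) / 2 := by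
  obtain ⟨h1, h2⟩ := abs_lt.1 hz
  rw [Real.artanh_eq_half_log ⟨h1.le, h2.le⟩, Real.log_div (by linarith) (by linarith)]
  ring

theorem hasSum_mul_artanh {z : ℝ} (hz : |z| < 1) :
    HasSum (fun k : ℕ ↦ (z ^ 2) ^ (k + 1) / (2 * k + 1)) (z * Real.artanh z) := by
  rw [artanh_eq_half_log_sub_log hz]
  have h := (Real.hasSum_log_sub_log_of_abs_lt_one hz).mul_left (z / 2)
  convert! h using 1
  · funext k
    field_simp
    ring
  · ring

theorem hasSum_neg_log_one_sub_sq {z : ℝ} (hz : |z| < 1) :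
    HasSum (fun k : ℕ ↦ (z ^ 2) ^ (k + 1) / (k + 1)) (-Real.log (1 - z ^ 2)) :=
  Real.hasSum_pow_div_log_of_abs_lt_one
    (by rw [abs_pow]; exact pow_lt_one₀ (abs_nonneg _) hz two_ne_zero)

/-- `log 2` minus the entropy of a Bernoulli variable with mean `(1 + z) / 2`. -/
noncomputable def negEntropy (z : ℝ) : ℝ := z * Real.artanh z + Real.log (1 - z ^ 2) / 2

theorem hasSum_negEntropy {z : ℝ} (hz : |z| < 1) :
    HasSum (fun k : ℕ ↦ (z ^ 2) ^ (k + 1) / ((2 * k + 1) * (2 * k + 2))) (negEntropy z) := by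
  have h := (hasSum_mul_artanh hz).sub ((hasSum_neg_log_one_sub_sq hz).div_const 2)
  convert! h using 1
  · funext k
    field_simp
    ring
  · rw [negEntropy]; ring

theorem negEntropy_mono {w z : ℝ} (hw : 0 ≤ w) (hwz : w ≤ z) (hz : z < 1) :
    negEntropy w ≤ negEntropy z := by
  refine hasSum_le (fun k ↦ ?_) (hasSum_negEntropy (abs_lt.2 ⟨by linarith, hwz.trans_lt hz⟩))
    (hasSum_negEntropy (abs_lt.2 ⟨by linarith, hz⟩))
  gcongr

/-- Equivalent to the nonnegativity of `negEntropy`. -/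
theorem neg_log_one_sub_sq_le {z : ℝ} (hz : |z| < 1) :
    -Real.log (1 - z ^ 2) ≤ 2 * (z * Real.artanh z) := by
  have h : 0 ≤ negEntropy z := (hasSum_negEntropy hz).nonneg fun k ↦ by positivity
  rw [negEntropy] at h
  linarith

/-- The coefficients of the power series of both sides in `z ^ 2` are comparable, by Bernoulli's
inequality `1 + k (r ^ 2 - 1) ≤ (r ^ 2) ^ k`. -/
theorem one_add_sq_mul_artanh_le {r z : ℝ} (hr : 0 ≤ r) (hr1 : r ≤ 1) (hz : |z| < 1) :
    (1 + r) ^ 2 / 2 * (z * Real.artanh z) ≤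
      r * (z * Real.artanh z) + negEntropy (r * z) - Real.log (1 - z ^ 2) / 2 := by
  have hrz : |r * z| < 1 := by
    rw [abs_mul, abs_of_nonneg hr]
    exact (mul_le_of_le_one_left (abs_nonneg z) hr1).trans_lt hz
  have h := (((hasSum_mul_artanh hz).mul_left r).add (hasSum_negEntropy hrz)).add
    ((hasSum_neg_log_one_sub_sq hz).div_const 2)
  rw [sub_eq_add_neg, ← neg_div]
  refine hasSum_le (fun k ↦ ?_) ((hasSum_mul_artanh hz).mul_left ((1 + r) ^ 2 / 2)) h
  have hb := one_add_mul_le_pow (a := r ^ 2 - 1) (by nlinarith [sq_nonneg r]) (k + 1)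
  rw [add_sub_cancel] at hb
  push_cast at hb
  have hp : 0 ≤ (z ^ 2) ^ (k + 1) := by positivity
  rw [mul_pow, mul_pow]
  refine sub_nonneg.1 ?_
  have : r * ((z ^ 2) ^ (k + 1) / (2 * k + 1)) +
      (r ^ 2) ^ (k + 1) * (z ^ 2) ^ (k + 1) / ((2 * k + 1) * (2 * k + 2)) +
      (z ^ 2) ^ (k + 1) / (k + 1) / 2 - (1 + r) ^ 2 / 2 * ((z ^ 2) ^ (k + 1) / (2 * k + 1)) =
      (z ^ 2) ^ (k + 1) * ((r ^ 2) ^ (k + 1) - (1 + (k + 1) * (r ^ 2 - 1))) /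
        ((2 * k + 1) * (2 * k + 2)) := by
    field_simp
    ring
  rw [this]
  exact div_nonneg (mul_nonneg hp (sub_nonneg.2 hb)) (by positivity)

/-- The mean of `X` at the exit time, for the drift `1`: the upper end of the interval is reached
with probability `1 - β`, and the lower one with probability `β`. It is half of the relative
entropy of the Bernoulli distribution with mean `β` with respect to the one with mean `1 - α`. -/
noncomputable def exitMean (α β : ℝ) : ℝ :=
  (1 - β) * (1 / 2 * Real.log ((1 - β) / α)) + β * (1 / 2 * Real.log (β / (1 - α)))

/-- The parametrization of the error probabilities by `α = (1 - z) / 2` and `β = (1 - w) / 2` turns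
the logarithms into `artanh`. -/
theorem exitMean_eq {z w : ℝ} (hz : |z| < 1) (hw : |w| < 1) :
    2 * exitMean ((1 - z) / 2) ((1 - w) / 2) =
      w * Real.artanh z + negEntropy w - Real.log (1 - z ^ 2) / 2 := by
  obtain ⟨hz1, hz2⟩ := abs_lt.1 hz
  obtain ⟨hw1, hw2⟩ := abs_lt.1 hw
  have e1 : (1 - (1 - w) / 2) / ((1 - z) / 2) = (1 + w) / (1 - z) := by
    have : 1 - z ≠ 0 := by linarith
    field_simp; ring
  have e2 : (1 - w) / 2 / (1 - (1 - z) / 2) = (1 - w) / (1 + z) := by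
    have : 1 + z ≠ 0 := by linarith
    rw [show 1 - (1 - z) / 2 = (1 + z) / 2 by ring]
    field_simp
  have e3 (t : ℝ) (h1 : -1 < t) (h2 : t < 1) :
      Real.log (1 - t ^ 2) = Real.log (1 - t) + Real.log (1 + t) := by
    rw [← Real.log_mul (by linarith) (by linarith)]
    ring_nf
  rw [exitMean, negEntropy, artanh_eq_half_log_sub_log hz, artanh_eq_half_log_sub_log hw, e1, e2,
    e3 z hz1 hz2, e3 w hw1 hw2, Real.log_div (by linarith) (by linarith),
    Real.log_div (by linarith) (by linarith)]
  ring

theorem exitMean_self {z : ℝ} (hz : |z| < 1) :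
    exitMean ((1 - z) / 2) ((1 - z) / 2) = z * Real.artanh z := by
  have h := exitMean_eq hz hz
  rw [negEntropy] at h
  linarith

theorem exitMean_self_eq (α : ℝ) :
    exitMean α α = (1 - 2 * α) / 2 * Real.log ((1 - α) / α) := by
  rw [exitMean, ← inv_div (1 - α) α, Real.log_inv]
  ring

theorem exitMean_nonneg {α β : ℝ} (hα : α ∈ Ioo (0 : ℝ) (1 / 2)) (hβ : β ∈ Ioo (0 : ℝ) (1 / 2)) :
    0 ≤ exitMean α β := by
  obtain ⟨hα0, hα1⟩ := hα
  obtain ⟨hβ0, hβ1⟩ := hβ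
  have hz : |1 - 2 * α| < 1 := abs_lt.2 ⟨by linarith, by linarith⟩
  have hw : |1 - 2 * β| < 1 := abs_lt.2 ⟨by linarith, by linarith⟩
  have h := exitMean_eq hz hw
  rw [show (1 - (1 - 2 * α)) / 2 = α by ring, show (1 - (1 - 2 * β)) / 2 = β by ring] at h
  have h1 : 0 ≤ (1 - 2 * β) * Real.artanh (1 - 2 * α) :=
    mul_nonneg (by linarith) (Real.artanh_nonneg (by linarith))
  have h2 : 0 ≤ negEntropy (1 - 2 * β) := (hasSum_negEntropy hw).nonneg fun k ↦ by positivity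
  have h3 : 0 ≤ -Real.log (1 - (1 - 2 * α) ^ 2) :=
    (hasSum_neg_log_one_sub_sq hz).nonneg fun k ↦ by positivity
  linarith

/-- With `z = 2 Φ (-Φ⁻¹ p) - 1`, the error probability `p` is `(1 - z) / 2`. -/
theorem two_Phi_neg_PhiInv_sub_one {p : ℝ} (hp : p ∈ Ioo (0 : ℝ) (1 / 2)) :
    (1 - (2 * Phi (-PhiInv p) - 1)) / 2 = p := by
  rw [Phi_neg, Phi_PhiInv ⟨hp.1, by linarith [hp.2]⟩]
  ring

theorem abs_two_Phi_sub_one_lt_one (x : ℝ) : |2 * Phi x - 1| < 1 :=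
  abs_lt.2 ⟨by linarith [Phi_pos x], by linarith [Phi_lt_one x]⟩

/-- The comparison with the symmetric case. With `x = -Φ⁻¹ α ≥ y = -Φ⁻¹ β`, concavity of `Φ` gives
`2 Φ y - 1 ≥ (y / x) (2 Φ x - 1)`, and `exitMean α β` increases in `2 Φ y - 1`. -/
theorem exitMean_self_div_le {α β : ℝ} (hα : α ∈ Ioo (0 : ℝ) (1 / 2))
    (hβ : β ∈ Ioo (0 : ℝ) (1 / 2)) (hαβ : α ≤ β) :
    exitMean α α / PhiInv α ^ 2 ≤ exitMean α β / ((PhiInv α + PhiInv β) ^ 2 / 4) := by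
  have hα1 : α ∈ Ioo (0 : ℝ) 1 := ⟨hα.1, by linarith [hα.2]⟩
  have hβ1 : β ∈ Ioo (0 : ℝ) 1 := ⟨hβ.1, by linarith [hβ.2]⟩
  obtain ⟨x, hx⟩ : ∃ x, x = -PhiInv α := ⟨_, rfl⟩
  obtain ⟨y, hy⟩ : ∃ y, y = -PhiInv β := ⟨_, rfl⟩
  have hyx : y ≤ x := by
    rw [hx, hy, neg_le_neg_iff, ← strictMono_Phi.le_iff_le, Phi_PhiInv hα1, Phi_PhiInv hβ1]
    exact hαβ
  have hy0 : 0 < y := by linarith [PhiInv_neg hβ]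
  have hx0 : 0 < x := hy0.trans_le hyx
  have hz := abs_two_Phi_sub_one_lt_one x
  have hw := abs_two_Phi_sub_one_lt_one y
  have ez := two_Phi_neg_PhiInv_sub_one hα
  have ew := two_Phi_neg_PhiInv_sub_one hβ
  rw [← hx] at ez
  rw [← hy] at ew
  set z := 2 * Phi x - 1 with hzdef
  set w := 2 * Phi y - 1 with hwdef
  have hz0 : 0 < z := two_Phi_sub_one_pos hx0
  have hw1 : w < 1 := (abs_lt.1 hw).2
  have hrw : y / x * z ≤ w := by
    rw [div_mul_eq_mul_div, div_le_iff₀ hx0]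
    linarith [mul_two_Phi_sub_one_le hy0.le hyx]
  have hA : 0 ≤ Real.artanh z := Real.artanh_nonneg hz0.le
  have h1 := one_add_sq_mul_artanh_le (r := y / x) (by positivity)
    ((div_le_one hx0).2 hyx) hz
  have h2 := negEntropy_mono (by positivity : 0 ≤ y / x * z) hrw hw1
  have h3 := mul_le_mul_of_nonneg_right hrw hA
  have key : (1 + y / x) ^ 2 / 2 * exitMean α α ≤ 2 * exitMean α β := by
    have e1 := exitMean_self hz
    have e2 := exitMean_eq hz hw
    rw [ez] at e1
    rw [ez, ew] at e2
    rw [e1, e2]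
    linarith
  rw [show PhiInv α = -x by linarith, show PhiInv β = -y by linarith, neg_sq,
    div_le_div_iff₀ (by positivity) (by nlinarith)]
  have e : (1 + y / x) ^ 2 / 2 * exitMean α α = exitMean α α * (x + y) ^ 2 / (2 * x ^ 2) := by
    field_simp
  rw [e, div_le_iff₀ (by positivity)] at key
  nlinarith

theorem quarter_le_exitMean_div {α : ℝ} (hα : α ∈ Ioo (0 : ℝ) (1 / 2)) :
    1 / 4 ≤ exitMean α α / PhiInv α ^ 2 := by
  obtain ⟨x, hx⟩ : ∃ x, x = -PhiInv α := ⟨_, rfl⟩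
  have hx0 : 0 < x := by linarith [PhiInv_neg hα]
  have hz := abs_two_Phi_sub_one_lt_one x
  have ez := two_Phi_neg_PhiInv_sub_one hα
  rw [← hx] at ez
  have e1 := exitMean_self hz
  rw [ez] at e1
  have hlog := Real.log_le_log (by nlinarith [abs_lt.1 hz])
    (one_sub_sq_two_Phi_sub_one_le hx0.le)
  rw [Real.log_exp] at hlog
  have h := neg_log_one_sub_sq_le hz
  rw [show PhiInv α = -x by linarith, neg_sq, le_div_iff₀ (by positivity), e1]
  linarith

/-! ### Optional stopping in continuous time -/

/-- The approximation of `S` from above by a time in the grid of mesh `1 / (n + 1)`, capped at the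
bound `t` of `S`. -/
noncomputable def gridTime {Ω : Type*} (S : Ω → ℝ≥0) (t : ℝ≥0) (n : ℕ) (ω : Ω) : ℝ≥0 :=
  min (⌈(n + 1) * S ω⌉₊ / (n + 1)) t

theorem countable_range_gridTime {Ω : Type*} (S : Ω → ℝ≥0) (t : ℝ≥0) (n : ℕ) :
    (range fun ω ↦ (gridTime S t n ω : WithTop ℝ≥0)).Countable := by
  refine (countable_range fun k : ℕ ↦ ((min (k / (n + 1)) t : ℝ≥0) : WithTop ℝ≥0)).mono ?_
  rintro _ ⟨ω, rfl⟩
  exact ⟨_, rfl⟩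

theorem isStoppingTime_gridTime {Ω : Type*} [mΩ : MeasurableSpace Ω]
    {F : Filtration ℝ≥0 mΩ} {S : Ω → ℝ≥0}
    (hS : ∀ s, MeasurableSet[F s] {ω | S ω ≤ s}) (t : ℝ≥0) (n : ℕ) :
    IsStoppingTime F fun ω ↦ (gridTime S t n ω : WithTop ℝ≥0) := by
  intro s
  have hn : (0 : ℝ≥0) < n + 1 := by positivity
  by_cases hts : t ≤ s
  · convert MeasurableSet.univ
    refine eq_univ_of_forall fun ω ↦ ?_
    exact WithTop.coe_le_coe.2 ((min_le_right _ _).trans hts)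
  · have h : {ω | (gridTime S t n ω : WithTop ℝ≥0) ≤ s}
        = {ω | S ω ≤ ⌊(n + 1) * s⌋₊ / (n + 1)} := by
      ext ω
      simp only [mem_ofPred_eq, WithTop.coe_le_coe, gridTime, min_le_iff, hts, or_false]
      rw [div_le_iff₀' hn, ← Nat.le_floor_iff zero_le, Nat.ceil_le, le_div_iff₀' hn]
    rw [h]
    refine F.mono ?_ _ (hS _)
    rw [div_le_iff₀' hn]
    exact Nat.floor_le zero_le

theorem tendsto_gridTime {Ω : Type*} {S : Ω → ℝ≥0} {t : ℝ≥0} (hSt : ∀ ω, S ω ≤ t) (ω : Ω) :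
    Tendsto (fun n ↦ gridTime S t n ω) atTop (𝓝 (S ω)) := by
  have h1 (n : ℕ) : S ω ≤ gridTime S t n ω := by
    refine le_min ?_ (hSt ω)
    rw [le_div_iff₀' (by positivity)]
    exact Nat.le_ceil _
  have h2 (n : ℕ) : gridTime S t n ω ≤ S ω + 1 / (n + 1) := by
    refine (min_le_left _ _).trans ?_
    rw [div_le_iff₀' (by positivity), mul_add, mul_one_div_cancel (by positivity)]
    exact (Nat.ceil_lt_add_one zero_le).le
  refine tendsto_of_tendsto_of_tendsto_of_le_of_le tendsto_const_nhds ?_ h1 h2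
  have := (tendsto_const_nhds (x := S ω)).add
    (tendsto_one_div_add_atTop_nhds_zero_nat (𝕜 := ℝ≥0))
  rwa [add_zero] at this

/-- Optional stopping for a martingale with continuous paths at a bounded stopping time: the values
at the grid times are conditional expectations of `M t`, hence uniformly integrable, and converge
to the value at `S`. -/
theorem integral_stopped_eq {Ω : Type*} [mΩ : MeasurableSpace Ω] {P : Measure Ω}
    [IsProbabilityMeasure P] {F : Filtration ℝ≥0 mΩ} {M : ℝ≥0 → Ω → ℝ}
    (hM : Martingale M F P) (hc : ∀ ω, Continuous (M · ω)) {S : Ω → ℝ≥0}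
    (hS : ∀ s, MeasurableSet[F s] {ω | S ω ≤ s}) {t : ℝ≥0} (hSt : ∀ ω, S ω ≤ t) :
    Integrable (fun ω ↦ M (S ω) ω) P ∧ ∫ ω, M (S ω) ω ∂P = ∫ ω, M 0 ω ∂P := by
  have hgrid (n : ℕ) := isStoppingTime_gridTime hS t n
  have hle (n : ℕ) (ω : Ω) : (gridTime S t n ω : WithTop ℝ≥0) ≤ t :=
    WithTop.coe_le_coe.2 (min_le_right _ _)
  have hcond (n : ℕ) : P[M t | (hgrid n).measurableSpace] =ᵐ[P]
      fun ω ↦ M (gridTime S t n ω) ω :=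
    (hM.stoppedValue_ae_eq_condExp_of_le_const_of_countable_range (hgrid n) (hle n)
      (countable_range_gridTime S t n)).symm
  have hui : UniformIntegrable (fun n ω ↦ M (gridTime S t n ω) ω) 1 P :=
    ((hM.integrable t).uniformIntegrable_condExp
      fun n ↦ (hgrid n).measurableSpace_le_of_le (hle n)).ae_eq hcond
  have hlim : ∀ᵐ ω ∂P, Tendsto (fun n ↦ M (gridTime S t n ω) ω) atTop (𝓝 (M (S ω) ω)) :=
    Eventually.of_forall fun ω ↦ ((hc ω).tendsto _).comp (tendsto_gridTime hSt ω)
  have hint : MemLp (fun ω ↦ M (S ω) ω) 1 P := hui.memLp_of_ae_tendsto hlim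
  have hL1 := tendsto_Lp_finite_of_tendsto_ae le_rfl ENNReal.one_ne_top hui.1 hint hui.2.1 hlim
  have hconv := tendsto_integral_of_L1' _ hint.1
    (Eventually.of_forall fun n ↦ memLp_one_iff_integrable.1 (hui.memLp n)) hL1
  have hconst (n : ℕ) : ∫ ω, M (gridTime S t n ω) ω ∂P = ∫ ω, M 0 ω ∂P := by
    rw [← integral_congr_ae (hcond n),
      integral_condExp ((hgrid n).measurableSpace_le_of_le (hle n)),
      ← integral_congr_ae (hM.condExp_ae_eq (zero_le : 0 ≤ t)), integral_condExp (F.le 0)]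
  simp_rw [hconst] at hconv
  exact ⟨memLp_one_iff_integrable.1 hint, tendsto_nhds_unique hconv tendsto_const_nhds⟩

/-! ### Exit times and increments -/

/-- By compactness of `[0, s]`, a continuous path stays in the open interval on `[0, s]` if and only
if it stays in some smaller closed interval at the times of a countable dense set. -/
theorem measurableSet_forall_le_mem_Ioo {Ω : Type*} [mΩ : MeasurableSpace Ω]
    {F : Filtration ℝ≥0 mΩ} {Y : ℝ≥0 → Ω → ℝ} (hY : ∀ t, Measurable[F t] (Y t))
    (hc : ∀ ω, Continuous (Y · ω)) (l u : ℝ) (s : ℝ≥0) :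
    MeasurableSet[F s] {ω | ∀ r ≤ s, Y r ω ∈ Ioo l u} := by
  obtain ⟨D, hD, hdense⟩ := TopologicalSpace.exists_countable_dense (Iic s)
  have h : {ω | ∀ r ≤ s, Y r ω ∈ Ioo l u} =
      ⋃ m : ℕ, ⋂ r ∈ D, Y r ⁻¹' Icc (l + 1 / (m + 1)) (u - 1 / (m + 1)) := by
    ext ω
    simp only [mem_ofPred_eq, mem_iUnion, mem_iInter, mem_preimage]
    constructor
    · intro h
      have hcomp : IsCompact (Iic s) := by rw [← Icc_bot]; exact isCompact_Icc
      obtain ⟨r₀, hr₀, hmin⟩ := hcomp.exists_isMinOn ⟨s, mem_Iic.2 le_rfl⟩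
        (f := fun r ↦ min (Y r ω - l) (u - Y r ω)) (by have := hc ω; fun_prop)
      have hpos : 0 < min (Y r₀ ω - l) (u - Y r₀ ω) :=
        lt_min (sub_pos.2 (h r₀ hr₀).1) (sub_pos.2 (h r₀ hr₀).2)
      obtain ⟨m, hm⟩ := exists_nat_one_div_lt hpos
      refine ⟨m, fun r _ ↦ ?_⟩
      have hr := hm.trans_le (hmin r.2)
      rw [lt_min_iff] at hr
      exact ⟨by linarith [hr.1], by linarith [hr.2]⟩
    · rintro ⟨m, hm⟩ r hr
      have hm0 : (0 : ℝ) < 1 / (m + 1) := by positivity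
      have hcl : IsClosed {r : Iic s | Y r ω ∈ Icc (l + 1 / ((m : ℝ) + 1)) (u - 1 / (m + 1))} :=
        isClosed_Icc.preimage ((hc ω).comp continuous_subtype_val)
      have := hcl.closure_subset_iff.2 (show D ⊆ _ from fun r hr ↦ hm r hr) (hdense ⟨r, hr⟩)
      exact ⟨by linarith [this.1], by linarith [this.2]⟩
  rw [h]
  exact MeasurableSet.iUnion fun m ↦ MeasurableSet.biInter hD fun r _ ↦
    F.mono r.2 _ (hY r measurableSet_Icc)

/-- The first exit time of `Y` from the open interval `(l, u)`, `∞` if there is none. -/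
noncomputable def exitTime {Ω : Type*} (Y : ℝ≥0 → Ω → ℝ) (l u : ℝ) : Ω → ℝ≥0∞ :=
  hittingAfter Y (Ioo l u)ᶜ 0

section path
variable {Ω : Type*} {Y : ℝ≥0 → Ω → ℝ} {l u : ℝ} {ω : Ω}

theorem lt_exitTime {r : ℝ≥0} (h : r < exitTime Y l u ω) : Y r ω ∈ Ioo l u :=
  not_not.1 (notMem_of_lt_hittingAfter h zero_le)

theorem exitTime_notMem (hc : Continuous (Y · ω)) (h : exitTime Y l u ω ≠ ∞) :
    Y (exitTime Y l u ω).toNNReal ω ∉ Ioo l u := by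
  classical
  have hex : ∃ j : ℝ≥0, 0 ≤ j ∧ Y j ω ∈ (Ioo l u)ᶜ := by
    by_contra hne
    push Not at hne
    exact h (hittingAfter_eq_top_iff.2 hne)
  have hcl : IsClosed {i : ℝ≥0 | 0 ≤ i ∧ Y i ω ∈ (Ioo l u)ᶜ} := by
    simp only [zero_le, true_and]
    exact isOpen_Ioo.isClosed_compl.preimage hc
  have hmem := hcl.csInf_mem hex (OrderBot.bddBelow _)
  have e : exitTime Y l u ω = ((sInf {i : ℝ≥0 | 0 ≤ i ∧ Y i ω ∈ (Ioo l u)ᶜ} : ℝ≥0) : ℝ≥0∞) :=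
    if_pos hex
  rw [e, ENNReal.toNNReal_coe]
  exact hmem.2

theorem mem_Icc_of_le_exitTime (hc : Continuous (Y · ω)) (h0 : Y 0 ω ∈ Ioo l u) {r : ℝ≥0}
    (h : r ≤ exitTime Y l u ω) : Y r ω ∈ Icc l u := by
  rcases eq_or_ne r 0 with rfl | hr
  · exact Ioo_subset_Icc_self h0
  have hcl : r ∈ closure (Iio r) := by
    rw [closure_Iio' ⟨0, pos_of_ne_zero hr⟩]
    exact mem_Iic.2 le_rfl
  refine (isClosed_Icc.preimage hc).closure_subset_iff.2 (fun q hq ↦ ?_) hcl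
  exact Ioo_subset_Icc_self (lt_exitTime ((ENNReal.coe_lt_coe.2 hq).trans_le h))

theorem exitTime_le_iff (hc : Continuous (Y · ω)) {s : ℝ≥0} :
    exitTime Y l u ω ≤ s ↔ ¬ ∀ r ≤ s, Y r ω ∈ Ioo l u := by
  constructor
  · intro h hall
    have hne : exitTime Y l u ω ≠ ∞ := (h.trans_lt ENNReal.coe_lt_top).ne
    exact exitTime_notMem hc hne (hall _ (ENNReal.toNNReal_mono ENNReal.coe_ne_top h))
  · intro h
    push Not at h
    obtain ⟨r, hr, hY⟩ := h
    exact (hittingAfter_le_of_mem zero_le hY).trans (ENNReal.coe_le_coe.2 hr)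

end path

/-- The exit time from `(l, u)`, capped at `t`. -/
noncomputable def cappedExitTime {Ω : Type*} (Y : ℝ≥0 → Ω → ℝ) (l u : ℝ) (t : ℝ≥0) (ω : Ω) : ℝ≥0 :=
  (min (exitTime Y l u ω) t).toNNReal

theorem coe_cappedExitTime {Ω : Type*} (Y : ℝ≥0 → Ω → ℝ) (l u : ℝ) (t : ℝ≥0) (ω : Ω) :
    (cappedExitTime Y l u t ω : ℝ≥0∞) = min (exitTime Y l u ω) t :=
  ENNReal.coe_toNNReal ((min_le_right _ _).trans_lt ENNReal.coe_lt_top).ne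

theorem cappedExitTime_le {Ω : Type*} (Y : ℝ≥0 → Ω → ℝ) (l u : ℝ) (t : ℝ≥0) (ω : Ω) :
    cappedExitTime Y l u t ω ≤ t := by
  rw [← ENNReal.coe_le_coe, coe_cappedExitTime]
  exact min_le_right _ _

theorem measurableSet_cappedExitTime_le {Ω : Type*} [mΩ : MeasurableSpace Ω]
    {F : Filtration ℝ≥0 mΩ} {Y : ℝ≥0 → Ω → ℝ} (hY : ∀ t, Measurable[F t] (Y t))
    (hc : ∀ ω, Continuous (Y · ω)) (l u : ℝ) (t s : ℝ≥0) :
    MeasurableSet[F s] {ω | cappedExitTime Y l u t ω ≤ s} := by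
  by_cases hts : t ≤ s
  · convert MeasurableSet.univ
    exact eq_univ_of_forall fun ω ↦ (cappedExitTime_le Y l u t ω).trans hts
  · convert (measurableSet_forall_le_mem_Ioo hY hc l u s).compl using 1
    ext ω
    rw [mem_ofPred_eq, mem_compl_iff, mem_ofPred_eq, ← exitTime_le_iff (hc ω),
      ← ENNReal.coe_le_coe, coe_cappedExitTime, min_le_iff, ENNReal.coe_le_coe]
    simp [hts]

section martingale
variable {Ω : Type*} [mΩ : MeasurableSpace Ω] {P : Measure Ω} {Y : ℝ≥0 → Ω → ℝ}

/-- The filtration generated by the process `Y`. -/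
noncomputable def pathFiltration (hm : ∀ t, Measurable (Y t)) : Filtration ℝ≥0 mΩ :=
  Filtration.natural Y fun t ↦ (hm t).stronglyMeasurable

theorem measurable_pathFiltration (hm : ∀ t, Measurable (Y t)) {s t : ℝ≥0} (hst : s ≤ t) :
    Measurable[pathFiltration hm t] (Y s) :=
  measurable_iff_comap_le.2 (le_iSup₂_of_le (f := fun j (_ : j ≤ t) ↦
    MeasurableSpace.comap (Y j) inferInstance) s hst le_rfl)

theorem hasLaw_increment (hB : IsPreBrownianReal (fun t ω ↦ Y t ω - t) P) {s t : ℝ≥0}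
    (hst : s ≤ t) :
    HasLaw (fun ω ↦ Y t ω - Y s ω) (gaussianReal (t - s) (t - s)) P := by
  have h := gaussianReal_add_const (hB.hasLaw_sub t s) (t - s)
  convert h using 2
  · simp only [Pi.sub_apply]
    ring
  · simp
  · ext
    simp [NNReal.coe_sub hst, Real.dist_eq, abs_of_nonneg (sub_nonneg.2 (NNReal.coe_le_coe.2 hst))]

/-- The increment of a Brownian motion with drift `1` after time `s` is independent of the past. -/
theorem condExp_increment (hm : ∀ t, Measurable (Y t))
    (hB : IsPreBrownianReal (fun t ω ↦ Y t ω - t) P) {s t : ℝ≥0} (hst : s ≤ t) {g : ℝ → ℝ}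
    (hg : Measurable g) :
    P[fun ω ↦ g (Y t ω - Y s ω) | pathFiltration hm s] =ᵐ[P]
      fun _ ↦ ∫ x, g x ∂gaussianReal (t - s) (t - s) := by
  have := hB.isGaussianProcess.isProbabilityMeasure
  have hmeas : Measurable fun ω ↦ Y t ω - Y s ω := (hm t).sub (hm s)
  have hlaw := hasLaw_increment hB hst
  have hind := hB.indepFun_shift s
  have hle : pathFiltration hm s ≤
      MeasurableSpace.comap (fun ω (r : Iic s) ↦ Y r ω - r) inferInstance := by
    refine iSup₂_le fun r hr ↦ ?_
    have e : Y r = (fun y : Iic s → ℝ ↦ y ⟨r, hr⟩ + r) ∘ fun ω (r : Iic s) ↦ Y r ω - r := by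
      ext ω; simp
    rw [e, ← MeasurableSpace.comap_comp]
    exact MeasurableSpace.comap_mono (by fun_prop : Measurable _).comap_le
  have hindep : Indep (MeasurableSpace.comap (fun ω ↦ Y t ω - Y s ω) inferInstance)
      (pathFiltration hm s) P := by
    refine indep_of_indep_of_le_right (indep_of_indep_of_le_left hind ?_) hle
    have e : (fun ω ↦ Y t ω - Y s ω) = (fun y : ℝ≥0 → ℝ ↦ y (t - s) + (t - s)) ∘
        fun ω r ↦ (Y (s + r) ω - (s + r : ℝ≥0)) - (Y s ω - s) := by
      ext ω
      simp only [Function.comp_apply, add_tsub_cancel_of_le hst]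
      ring
    rw [e, ← MeasurableSpace.comap_comp]
    exact MeasurableSpace.comap_mono (by fun_prop : Measurable _).comap_le
  refine (condExp_indep_eq hmeas.comap_le ((pathFiltration hm).le s)
    (hg.comp (comap_measurable _)).stronglyMeasurable hindep).trans ?_
  refine Eventually.of_forall fun _ ↦ ?_
  exact hlaw.integral_comp hg.aestronglyMeasurable

end martingale

/-! ### The mean exit time -/

section
variable {Ω : Type*} [mΩ : MeasurableSpace Ω] {P : Measure Ω} {Y : ℝ≥0 → Ω → ℝ}

theorem integrable_exp_comp_of_hasLaw_gaussianReal {X : Ω → ℝ} {μ : ℝ} {σ : ℝ≥0}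
    (hX : HasLaw X (gaussianReal μ σ) P) (c : ℝ) : Integrable (fun ω ↦ Real.exp (c * X ω)) P := by
  refine (integrable_map_measure (f := X) (g := fun x ↦ Real.exp (c * x)) (by fun_prop)
    hX.aemeasurable).1 ?_
  rw [hX.map_eq]
  exact integrable_exp_mul_gaussianReal c

theorem integrable_exp_neg_two_increment (hB : IsPreBrownianReal (fun t ω ↦ Y t ω - t) P)
    {s t : ℝ≥0} (hst : s ≤ t) :
    Integrable (fun ω ↦ Real.exp (-2 * (Y t ω - Y s ω))) P :=
  integrable_exp_comp_of_hasLaw_gaussianReal (hasLaw_increment hB hst) (-2)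

theorem integrable_exp_neg_two (hB : IsPreBrownianReal (fun t ω ↦ Y t ω - t) P) (t : ℝ≥0) :
    Integrable (fun ω ↦ Real.exp (-2 * Y t ω)) P := by
  have h := (integrable_exp_comp_of_hasLaw_gaussianReal (hB.hasLaw_eval t) (-2)).mul_const
    (Real.exp (-2 * t))
  refine h.congr (Eventually.of_forall fun ω ↦ ?_)
  beta_reduce
  rw [← Real.exp_add]
  ring_nf

theorem martingale_sub (hm : ∀ t, Measurable (Y t))
    (hB : IsPreBrownianReal (fun t ω ↦ Y t ω - t) P) :
    Martingale (fun t ω ↦ Y t ω - t) (pathFiltration hm) P := by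
  have := hB.isGaussianProcess.isProbabilityMeasure
  have hsm (t : ℝ≥0) : StronglyMeasurable[pathFiltration hm t] fun ω ↦ Y t ω - t :=
    ((measurable_pathFiltration hm le_rfl).sub_const _).stronglyMeasurable
  refine ⟨hsm, fun s t hst ↦ ?_⟩
  have hinc := condExp_increment hm hB hst (g := fun x ↦ x - (t - s)) (by fun_prop)
  have hdec : (fun ω ↦ Y t ω - t) =
      (fun ω ↦ Y s ω - s) + fun ω ↦ Y t ω - Y s ω - (t - s) := by
    ext ω
    simp only [Pi.add_apply]
    ring
  have hint : Integrable (fun ω ↦ Y t ω - Y s ω - (t - s)) P := by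
    refine ((hB.integrable_eval t).sub (hB.integrable_eval s)).congr
      (Eventually.of_forall fun ω ↦ ?_)
    simp only [Pi.sub_apply]
    ring
  beta_reduce
  rw [hdec]
  refine (condExp_add (hB.integrable_eval s) hint _).trans ?_
  rw [condExp_of_stronglyMeasurable ((pathFiltration hm).le s) (hsm s) (hB.integrable_eval s)]
  filter_upwards [hinc] with ω hω
  rw [Pi.add_apply, hω,
    integral_sub (by exact (memLp_id_gaussianReal 1).integrable le_rfl) (integrable_const _),
    integral_id_gaussianReal]
  simp

theorem martingale_exp_neg_two (hm : ∀ t, Measurable (Y t))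
    (hB : IsPreBrownianReal (fun t ω ↦ Y t ω - t) P) :
    Martingale (fun t ω ↦ Real.exp (-2 * Y t ω)) (pathFiltration hm) P := by
  have := hB.isGaussianProcess.isProbabilityMeasure
  have hsm (t : ℝ≥0) : StronglyMeasurable[pathFiltration hm t] fun ω ↦ Real.exp (-2 * Y t ω) :=
    (((measurable_pathFiltration hm le_rfl).const_mul (-2)).exp).stronglyMeasurable
  refine ⟨hsm, fun s t hst ↦ ?_⟩
  have hinc := condExp_increment hm hB hst (g := fun x ↦ Real.exp (-2 * x)) (by fun_prop)
  have hdec : (fun ω ↦ Real.exp (-2 * Y t ω)) =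
      (fun ω ↦ Real.exp (-2 * Y s ω)) * fun ω ↦ Real.exp (-2 * (Y t ω - Y s ω)) := by
    ext ω
    rw [Pi.mul_apply, ← Real.exp_add]
    ring_nf
  beta_reduce
  rw [hdec]
  refine (condExp_mul_of_stronglyMeasurable_left (hsm s)
    (hdec ▸ integrable_exp_neg_two hB t) (integrable_exp_neg_two_increment hB hst)).trans ?_
  filter_upwards [hinc] with ω hω
  have hmgf : ∫ x, Real.exp (-2 * x) ∂gaussianReal (t - s) (t - s) = 1 := by
    have h := congrFun (mgf_id_gaussianReal (μ := (t : ℝ) - s) (v := t - s)) (-2)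
    rw [mgf] at h
    rw [NNReal.coe_sub hst] at h
    simp only [id_eq] at h
    rw [h, Real.exp_eq_one_iff]
    ring
  rw [Pi.mul_apply, hω, hmgf, mul_one]

/-- The function `v x = c₁ - x + c₂ exp (-2 x)` solves `v'' / 2 + v' = -1`, so that `v (Y t) + t`
is a martingale. As `v` vanishes at the ends of the interval and is bounded on it, stopping at the
exit time shows that the mean exit time is `v 0`. -/
theorem lintegral_exitTime (hm : ∀ t, Measurable (Y t)) (hc : ∀ ω, Continuous (Y · ω))
    (hB : IsPreBrownianReal (fun t ω ↦ Y t ω - t) P) {l u c₁ c₂ : ℝ} (hl : l < 0) (hu : 0 < u)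
    (hcl : c₁ - l + c₂ * Real.exp (-2 * l) = 0) (hcu : c₁ - u + c₂ * Real.exp (-2 * u) = 0) :
    ∫⁻ ω, exitTime Y l u ω ∂P = ENNReal.ofReal (c₁ + c₂) := by
  have := hB.isGaussianProcess.isProbabilityMeasure
  have h0 : ∀ᵐ ω ∂P, Y 0 ω = 0 := by simpa using hB.eval_zero_ae_eq_zero
  set S : ℕ → Ω → ℝ≥0 := fun n ↦ cappedExitTime Y l u n with hSdef
  set v : ℝ → ℝ := fun x ↦ c₁ - x + c₂ * Real.exp (-2 * x) with hv
  have hvc : Continuous v := by fun_prop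
  set M : ℝ≥0 → Ω → ℝ := fun t ω ↦ v (Y t ω) + t with hMdef
  have hM : Martingale M (pathFiltration hm) P := by
    have h := ((martingale_const (pathFiltration hm) P c₁).sub (martingale_sub hm hB)).add
      ((martingale_exp_neg_two hm hB).smul c₂)
    convert h using 1
    ext t ω
    simp only [hMdef, hv, Pi.add_apply, Pi.sub_apply, Pi.smul_apply, smul_eq_mul]
    ring
  have hS (n : ℕ) (s : ℝ≥0) : MeasurableSet[pathFiltration hm s] {ω | S n ω ≤ s} :=
    measurableSet_cappedExitTime_le (fun t ↦ measurable_pathFiltration hm le_rfl) hc l u n s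
  have hSm (n : ℕ) : Measurable (S n) :=
    measurable_of_Iic fun s ↦ (pathFiltration hm).le s _ (hS n s)
  have hSle (n : ℕ) (ω : Ω) : S n ω ≤ n := cappedExitTime_le Y l u n ω
  have hSint (n : ℕ) : Integrable (fun ω ↦ (S n ω : ℝ)) P := by
    refine Integrable.of_bound (by have := hSm n; fun_prop) n (Eventually.of_forall fun ω ↦ ?_)
    rw [Real.norm_of_nonneg (NNReal.coe_nonneg _)]
    exact_mod_cast hSle n ω
  -- optional stopping of `v (Y t) + t` at the exit time capped at `n`
  have hopt (n : ℕ) : Integrable (fun ω ↦ v (Y (S n ω) ω)) P ∧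
      ∫ ω, (S n ω : ℝ) ∂P = c₁ + c₂ - ∫ ω, v (Y (S n ω) ω) ∂P := by
    obtain ⟨h1, h2⟩ := integral_stopped_eq hM
      (fun ω ↦ by have := hc ω; simp only [hMdef]; fun_prop) (hS n) (hSle n)
    have h3 : Integrable (fun ω ↦ v (Y (S n ω) ω)) P := by
      refine (h1.sub (hSint n)).congr (Eventually.of_forall fun ω ↦ ?_)
      simp [hMdef]
    have h4 : ∫ ω, M 0 ω ∂P = c₁ + c₂ := by
      rw [integral_congr_ae (g := fun _ ↦ c₁ + c₂) ?_]
      · simp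
      · filter_upwards [h0] with ω hω
        simp [hMdef, hv, hω]
    simp only [hMdef] at h2 h4
    rw [integral_add h3 (hSint n), h4] at h2
    exact ⟨h3, by linarith⟩
  obtain ⟨C, hC⟩ := isCompact_Icc.exists_bound_of_continuousOn (s := Icc l u) hvc.continuousOn
  have hbound (n : ℕ) : ∀ᵐ ω ∂P, ‖v (Y (S n ω) ω)‖ ≤ C := by
    filter_upwards [h0] with ω hω
    refine hC _ (mem_Icc_of_le_exitTime (hc ω) (by rw [hω]; exact ⟨hl, hu⟩) ?_)
    rw [hSdef, coe_cappedExitTime]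
    exact min_le_left _ _
  have hlint (n : ℕ) : ∫⁻ ω, (S n ω : ℝ≥0∞) ∂P =
      ENNReal.ofReal (c₁ + c₂ - ∫ ω, v (Y (S n ω) ω) ∂P) := by
    rw [← (hopt n).2, ofReal_integral_eq_lintegral_ofReal (hSint n)
      (Eventually.of_forall fun ω ↦ NNReal.coe_nonneg _)]
    simp
  have hStend (ω : Ω) :
      Tendsto (fun n ↦ (S n ω : ℝ≥0∞)) atTop (𝓝 (exitTime Y l u ω)) := by
    simp only [hSdef, coe_cappedExitTime]
    have := (tendsto_const_nhds (x := exitTime Y l u ω)).min ENNReal.tendsto_nat_nhds_top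
    rw [min_eq_left le_top] at this
    simpa using this
  have hmono : Tendsto (fun n ↦ ∫⁻ ω, (S n ω : ℝ≥0∞) ∂P) atTop
      (𝓝 (∫⁻ ω, exitTime Y l u ω ∂P)) := by
    refine lintegral_tendsto_of_tendsto_of_monotone
      (fun n ↦ (hSm n).coe_nnreal_ennreal.aemeasurable) ?_ ?_
    · refine Eventually.of_forall fun ω m n hmn ↦ ?_
      simp only [hSdef, coe_cappedExitTime]
      gcongr
    · exact Eventually.of_forall hStend
  have hfin : ∫⁻ ω, exitTime Y l u ω ∂P ≠ ∞ := by
    refine ((le_of_tendsto hmono (Eventually.of_forall fun n ↦ ?_)).trans_lt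
      (ENNReal.ofReal_lt_top (r := c₁ + c₂ + C))).ne
    rw [hlint]
    refine ENNReal.ofReal_le_ofReal ?_
    have := norm_integral_le_of_norm_le_const (hbound n)
    rw [probReal_univ, mul_one, Real.norm_eq_abs] at this
    linarith [neg_le_of_abs_le this]
  have hmeas : AEMeasurable (exitTime Y l u) P := by
    refine aemeasurable_of_tendsto_metrizable_ae atTop
      (fun n ↦ (hSm n).coe_nnreal_ennreal.aemeasurable) (Eventually.of_forall hStend)
  have hvanish : ∀ᵐ ω ∂P, Tendsto (fun n ↦ v (Y (S n ω) ω)) atTop (𝓝 0) := by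
    filter_upwards [h0, ae_lt_top' hmeas hfin] with ω hω hτ
    set r := (exitTime Y l u ω).toNNReal with hr
    have hre : (r : ℝ≥0∞) = exitTime Y l u ω := ENNReal.coe_toNNReal hτ.ne
    have hend : v (Y r ω) = 0 := by
      have h1 := mem_Icc_of_le_exitTime (hc ω) (by rw [hω]; exact ⟨hl, hu⟩) hre.le
      have h2 := exitTime_notMem (hc ω) hτ.ne
      rw [← hr, mem_Ioo, not_and_or, not_lt, not_lt] at h2
      rcases h2 with h2 | h2
      · rw [h1.1.antisymm' h2]; exact hcl
      · rw [h1.2.antisymm h2]; exact hcu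
    obtain ⟨N, hN⟩ := exists_nat_ge r
    refine tendsto_const_nhds.congr' ((eventually_ge_atTop N).mono fun n hn ↦ ?_)
    have : S n ω = r := by
      rw [← ENNReal.coe_inj, hSdef, coe_cappedExitTime, ← hre, min_eq_left]
      exact_mod_cast hN.trans (by exact_mod_cast hn)
    beta_reduce
    rw [this, hend]
  have hlim : Tendsto (fun n ↦ ∫ ω, v (Y (S n ω) ω) ∂P) atTop (𝓝 (∫ _, (0 : ℝ) ∂P)) :=
    tendsto_integral_of_dominated_convergence (fun _ ↦ C) (fun n ↦ (hopt n).1.1)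
      (integrable_const _) hbound hvanish
  rw [integral_zero] at hlim
  have hfinal := ENNReal.tendsto_ofReal (hlim.const_sub (c₁ + c₂))
  rw [sub_zero] at hfinal
  simp_rw [hlint] at hmono
  exact tendsto_nhds_unique hmono hfinal
end

/-! ### The mean of the sequential test -/

section
variable {Ω : Type*} [mΩ : MeasurableSpace Ω] {P : Measure Ω} {X : ℝ≥0 → Ω → ℝ}

/-- The paths are continuous only almost surely; on a null set they can be replaced by `0`. -/
theorem exists_continuous_version (hX : IsBrownianWithDrift X 1 P) :
    ∃ Y : ℝ≥0 → Ω → ℝ, (∀ t, Measurable (Y t)) ∧ (∀ ω, Continuous (Y · ω)) ∧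
      ∀ᵐ ω ∂P, ∀ t, X t ω = Y t ω := by
  have hcont : ∀ᵐ ω ∂P, Continuous (X · ω) := by
    filter_upwards [hX.brownian.cont] with ω hω
    have : Continuous fun t : ℝ≥0 ↦ (X t ω - 1 * (t : ℝ)) + 1 * (t : ℝ) := by fun_prop
    simpa using this
  set N := toMeasurable P {ω | ¬ Continuous (X · ω)} with hN
  have hNm : MeasurableSet N := measurableSet_toMeasurable _ _
  have hN0 : P N = 0 := by rw [hN, measure_toMeasurable]; exact hcont
  refine ⟨fun t ↦ Nᶜ.indicator (X t), fun t ↦ (hX.measurable t).indicator hNm.compl,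
    fun ω ↦ ?_, ?_⟩
  · by_cases hω : ω ∈ N
    · simp [hω, continuous_const]
    · simp only [indicator_of_mem (mem_compl hω)]
      by_contra h
      exact hω (subset_toMeasurable _ _ h)
  · filter_upwards [compl_mem_ae_iff.2 hN0] with ω hω t
    rw [indicator_of_mem hω]

theorem hittingAfter_zero_congr {Ω : Type*} {X Y : ℝ≥0 → Ω → ℝ} {s s' : Set ℝ} {ω : Ω}
    (h : ∀ t, X t ω ∈ s ↔ Y t ω ∈ s') : hittingAfter X s 0 ω = hittingAfter Y s' 0 ω := by
  have hset : {i : ℝ≥0 | 0 ≤ i ∧ X i ω ∈ s} = {i | 0 ≤ i ∧ Y i ω ∈ s'} := by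
    ext i
    simp [h]
  have hex : (∃ i : ℝ≥0, 0 ≤ i ∧ X i ω ∈ s) ↔ ∃ i : ℝ≥0, 0 ≤ i ∧ Y i ω ∈ s' := by
    simp [h]
  simp only [hittingAfter, hset]
  split_ifs with h₁ h₂ h₂
  · rfl
  · exact absurd (hex.1 h₁) h₂
  · exact absurd (hex.2 h₂) h₁
  · rfl

/-- Reflection exchanges the two hypotheses, and with them the two error probabilities. -/
theorem sprtTime_neg {Ω : Type*} (X : ℝ≥0 → Ω → ℝ) (α β : ℝ) :
    sprtTime (fun t ω ↦ -X t ω) β α = sprtTime X α β := by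
  have h (p q : ℝ) : 1 / 2 * Real.log (p / q) = -(1 / 2 * Real.log (q / p)) := by
    rw [← inv_div q p, Real.log_inv]; ring
  have hmem (ω : Ω) (t : ℝ≥0) :
      -X t ω ∈ (Ioo (1 / 2 * Real.log (α / (1 - β))) (1 / 2 * Real.log ((1 - α) / β)))ᶜ ↔
        X t ω ∈ (Ioo (1 / 2 * Real.log (β / (1 - α))) (1 / 2 * Real.log ((1 - β) / α)))ᶜ := by
    rw [h α, h (1 - α), mem_compl_iff, mem_compl_iff, neg_mem_Ioo_iff, neg_neg, neg_neg]
  ext ω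
  exact hittingAfter_zero_congr (hmem ω)

theorem sprtMean_of_drift_one (hX : IsBrownianWithDrift X 1 P) {α β : ℝ}
    (hα : α ∈ Ioo (0 : ℝ) (1 / 2)) (hβ : β ∈ Ioo (0 : ℝ) (1 / 2)) :
    sprtMean X P α β = ENNReal.ofReal (exitMean α β) := by
  obtain ⟨hα0, hα1⟩ := hα
  obtain ⟨hβ0, hβ1⟩ := hβ
  obtain ⟨Y, hm, hc, hXY⟩ := exists_continuous_version hX
  have hB : IsPreBrownianReal (fun t ω ↦ Y t ω - t) P :=
    hX.brownian.toIsPreBrownianReal.congr fun t ↦ by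
      filter_upwards [hXY] with ω hω
      rw [hω, one_mul]
  set l := 1 / 2 * Real.log (β / (1 - α)) with hl
  set u := 1 / 2 * Real.log ((1 - β) / α) with hu
  have hl0 : l < 0 := by
    have := Real.log_neg (div_pos hβ0 (by linarith : 0 < 1 - α))
      ((div_lt_one (by linarith)).2 (by linarith))
    linarith
  have hu0 : 0 < u := by
    have := Real.log_pos ((one_lt_div hα0).2 (by linarith : α < 1 - β))
    linarith
  have hel : Real.exp (-2 * l) = (1 - α) / β := by
    rw [hl, show -2 * (1 / 2 * Real.log (β / (1 - α))) = -Real.log (β / (1 - α)) by ring,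
      Real.exp_neg, Real.exp_log (div_pos hβ0 (by linarith)), inv_div]
  have heu : Real.exp (-2 * u) = α / (1 - β) := by
    rw [hu, show -2 * (1 / 2 * Real.log ((1 - β) / α)) = -Real.log ((1 - β) / α) by ring,
      Real.exp_neg, Real.exp_log (div_pos (by linarith) hα0), inv_div]
  have hβ' : 1 - β ≠ 0 := by linarith
  have hαβ : 1 - α - β ≠ 0 := by linarith
  have hmean : sprtMean X P α β = ∫⁻ ω, exitTime Y l u ω ∂P := by
    refine lintegral_congr_ae ?_
    filter_upwards [hXY] with ω hω
    exact hittingAfter_zero_congr fun t ↦ by rw [hω t]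
  -- `c₁` and `c₂` are determined by the two boundary conditions
  rw [hmean, lintegral_exitTime hm hc hB (c₁ := u + (u - l) * β * α / (1 - α - β))
    (c₂ := -((u - l) * β * (1 - β) / (1 - α - β))) hl0 hu0
    (by rw [hel]; field_simp; ring) (by rw [heu]; field_simp; ring)]
  congr 1
  rw [exitMean, ← hl, ← hu]
  field_simp
  ring

theorem sprtMean_of_drift_neg_one (hX : IsBrownianWithDrift X (-1) P) {α β : ℝ}
    (hα : α ∈ Ioo (0 : ℝ) (1 / 2)) (hβ : β ∈ Ioo (0 : ℝ) (1 / 2)) :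
    sprtMean X P α β = ENNReal.ofReal (exitMean β α) := by
  have hneg : IsBrownianWithDrift (fun t ω ↦ -X t ω) 1 P := by
    refine ⟨fun t ↦ (hX.measurable t).neg, ?_⟩
    convert hX.brownian.neg using 1
    ext t ω
    simp only [Pi.neg_apply]
    ring
  rw [← sprtMean_of_drift_one hneg hβ hα, sprtMean, sprtMean, sprtTime_neg]
end

/-! ### The minimal fixed sample size -/

/-- The bridge of the path `x` on `[0, T]`: its deviation from the chord between the times `0` and
`T`. For `T = 0` the quotient is `0`, which leaves the path `x 0` itself. -/
noncomputable def bridge (T : ℝ≥0) (x : ℝ≥0 → ℝ) (s : Iic T) : ℝ := x s - s / T * x T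

theorem measurable_bridge (T : ℝ≥0) : Measurable (bridge T) := by
  unfold bridge
  fun_prop

/-- The bridge does not see the drift. -/
theorem bridge_sub_mul (T : ℝ≥0) (x : ℝ≥0 → ℝ) (θ : ℝ) :
    bridge T (fun t ↦ x t - θ * t) = bridge T x := by
  funext s
  simp only [bridge]
  rcases eq_or_ne T 0 with rfl | hT
  · have : (s : ℝ≥0) = 0 := le_antisymm s.2 zero_le
    simp [this]
  · have : (T : ℝ) ≠ 0 := by exact_mod_cast hT
    field_simp
    ring

theorem _root_.ProbabilityTheory.IsPreBrownianReal.indepFun_bridge {Ω : Type*} [MeasurableSpace Ω]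
    {B : ℝ≥0 → Ω → ℝ} {P : Measure Ω} (hB : IsPreBrownianReal B P) (T : ℝ≥0) :
    IndepFun (fun ω ↦ bridge T (B · ω)) (B T) P := by
  have := hB.isGaussianProcess.isProbabilityMeasure
  have hbr (s : Iic T) : AEMeasurable (fun ω ↦ bridge T (B · ω) s) P :=
    (hB.aemeasurable _).sub ((hB.aemeasurable _).const_mul _)
  have h : IndepFun (fun ω s ↦ bridge T (B · ω) s) (fun ω (_ : Unit) ↦ B T ω) P := by
    refine IsGaussianProcess.indepFun_of_covariance_eq_zero
      (X := fun s ω ↦ bridge T (B · ω) s) (Y := fun _ ↦ B T) ?_ hbr (fun _ ↦ hB.aemeasurable T) ?_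
    · apply hB.isGaussianProcess.of_isGaussianProcess
      rintro (s | _)
      · exact ⟨{s.1, T},
          { toFun x := x ⟨s.1, by simp⟩ - s / T * x ⟨T, by simp⟩
            map_add' x y := by simp; ring
            map_smul' c x := by simp; ring }, by simp [bridge]⟩
      · exact ⟨{T},
          { toFun x := x ⟨T, by simp⟩
            map_add' x y := by simp
            map_smul' c x := by simp }, by simp⟩
    · rintro ⟨s, hs⟩ -
      have hL (t : ℝ≥0) : MemLp (B t) 2 P := (hB.isGaussianProcess.hasGaussianLaw_eval _).memLp_two
      simp only [bridge]
      rw [covariance_fun_sub_left (hL _) ((hL _).const_mul _) (hL _), covariance_const_mul_left,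
        hB.covariance_eval, hB.covariance_eval, min_eq_left (mem_Iic.1 hs), min_self]
      rcases eq_or_ne T 0 with rfl | hT
      · simp [le_antisymm (mem_Iic.1 hs) zero_le]
      · have : (T : ℝ) ≠ 0 := by exact_mod_cast hT
        field_simp
        ring
  exact h.comp measurable_id (measurable_pi_apply ())

/-- The law of a pre-Brownian motion on the path space is unique. -/
theorem _root_.ProbabilityTheory.IsPreBrownianReal.map_eq_map {Ω Ω' : Type*} [MeasurableSpace Ω]
    [MeasurableSpace Ω'] {B : ℝ≥0 → Ω → ℝ} {B' : ℝ≥0 → Ω' → ℝ} {P : Measure Ω} {P' : Measure Ω'}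
    (hB : IsPreBrownianReal B P) (hB' : IsPreBrownianReal B' P') (hm : ∀ t, Measurable (B t))
    (hm' : ∀ t, Measurable (B' t)) :
    P.map (fun ω ↦ (B · ω)) = P'.map (fun ω ↦ (B' · ω)) := by
  have h := isProjectiveLimit_map (P := P) (X := B) (measurable_pi_lambda _ hm).aemeasurable
  have h' := isProjectiveLimit_map (P := P') (X := B') (measurable_pi_lambda _ hm').aemeasurable
  simp_rw [fun I ↦ (hB.hasLaw I).map_eq] at h
  simp_rw [fun I ↦ (hB'.hasLaw I).map_eq] at h'
  exact h.unique h'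

theorem gaussianReal_withDensity_exp (v : ℝ≥0) :
    (gaussianReal (-v) v).withDensity (fun x ↦ ENNReal.ofReal (Real.exp (2 * x))) =
      gaussianReal v v := by
  rcases eq_or_ne v 0 with rfl | hv
  · have : (Measure.dirac (0 : ℝ)).withDensity (fun x ↦ ENNReal.ofReal (Real.exp (2 * x))) =
        Measure.dirac 0 := by
      rw [dirac_withDensity]
      simp
    simpa using this
  · rw [gaussianReal_of_var_ne_zero _ hv, gaussianReal_of_var_ne_zero _ hv,
      ← withDensity_mul _ (measurable_gaussianPDF _ _) (by fun_prop)]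
    congr 1
    funext x
    have hv' : (v : ℝ) ≠ 0 := by exact_mod_cast hv
    rw [Pi.mul_apply, gaussianPDF, gaussianPDF,
      ← ENNReal.ofReal_mul (gaussianPDFReal_nonneg _ _ _), gaussianPDFReal, gaussianPDFReal,
      mul_assoc, ← Real.exp_add]
    congr 3
    field_simp
    ring

section drift
variable {Ω : Type*} [mΩ : MeasurableSpace Ω] {X : ℝ≥0 → Ω → ℝ} {P : Measure Ω} {θ : ℝ}

theorem IsBrownianWithDrift.isProbabilityMeasure (hX : IsBrownianWithDrift X θ P) :
    IsProbabilityMeasure P := hX.brownian.isGaussianProcess.isProbabilityMeasure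

theorem IsBrownianWithDrift.hasLaw_eval (h : IsBrownianWithDrift X θ P) (T : ℝ≥0) :
    HasLaw (X T) (gaussianReal (θ * T) T) P := by
  have h1 := gaussianReal_add_const (h.brownian.hasLaw_eval T) (θ * T)
  simpa using h1

theorem IsBrownianWithDrift.map_bridge_prod (h : IsBrownianWithDrift X θ P) (T : ℝ≥0) :
    P.map (fun ω ↦ (bridge T (X · ω), X T ω)) =
      (P.map fun ω ↦ bridge T (X · ω)).prod (gaussianReal (θ * T) T) := by
  have := h.isProbabilityMeasure
  have hbr : Measurable fun ω ↦ bridge T (X · ω) :=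
    (measurable_bridge T).comp (measurable_pi_lambda _ h.measurable)
  have hind := (h.brownian.indepFun_bridge T).comp measurable_id (measurable_add_const (θ * T))
  have e1 : (fun ω ↦ bridge T fun t ↦ X t ω - θ * t) = fun ω ↦ bridge T (X · ω) := by
    funext ω
    exact bridge_sub_mul T (X · ω) θ
  rw [e1] at hind
  have e2 : ((· + θ * T) ∘ fun ω ↦ X T ω - θ * T) = X T := by
    funext ω
    simp
  rw [e2] at hind
  rw [← (h.hasLaw_eval T).map_eq]
  exact hind.map_prod_eq_prod_map_map hbr.aemeasurable (h.measurable T).aemeasurable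

theorem observed_le (hm : ∀ t, Measurable (X t)) (T : ℝ≥0) : observed X T ≤ mΩ :=
  iSup₂_le fun s _ ↦ (hm s).comap_le

/-- The observations on `[0, T]` are determined by the bridge and the final value. -/
theorem exists_preimage_of_measurableSet_observed {Ω : Type*} {X : ℝ≥0 → Ω → ℝ} {T : ℝ≥0}
    {A : Set Ω} (hA : MeasurableSet[observed X T] A) :
    ∃ E : Set ((Iic T → ℝ) × ℝ), MeasurableSet E ∧
      (fun ω ↦ (bridge T (X · ω), X T ω)) ⁻¹' E = A := by
  have hle : observed X T ≤
      MeasurableSpace.comap (fun ω ↦ (bridge T (X · ω), X T ω)) inferInstance := by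
    refine iSup₂_le fun s hs ↦ ?_
    have e : X s = (fun p : (Iic T → ℝ) × ℝ ↦ p.1 ⟨s, hs⟩ + s / T * p.2) ∘
        fun ω ↦ (bridge T (X · ω), X T ω) := by
      funext ω
      simp [bridge]
    rw [e, ← MeasurableSpace.comap_comp]
    exact MeasurableSpace.comap_mono (by fun_prop : Measurable _).comap_le
  exact hle _ hA

/-- The likelihood ratio of the two hypotheses given the observation on `[0, T]` is `exp (2 X T)`:
`X T` is sufficient, since the bridge is independent of it and has the same law under both. -/
theorem measure_eq_lintegral_exp {Pneg Ppos : Measure Ω} (hneg : IsBrownianWithDrift X (-1) Pneg)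
    (hpos : IsBrownianWithDrift X 1 Ppos) {T : ℝ≥0} {A : Set Ω}
    (hA : MeasurableSet[observed X T] A) :
    Ppos A = ∫⁻ ω in A, ENNReal.ofReal (Real.exp (2 * X T ω)) ∂Pneg := by
  have := hneg.isProbabilityMeasure
  have hX := hpos.measurable
  obtain ⟨E, hE, rfl⟩ := exists_preimage_of_measurableSet_observed hA
  have hbr : Measurable fun ω ↦ bridge T (X · ω) :=
    (measurable_bridge T).comp (measurable_pi_lambda _ hX)
  have hZ : Measurable fun ω ↦ (bridge T (X · ω), X T ω) := hbr.prodMk (hX T)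
  have hlaw {θ : ℝ} {P : Measure Ω} (h : IsBrownianWithDrift X θ P) :
      (P.map fun ω ↦ bridge T (X · ω)) =
        (P.map fun ω t ↦ X t ω - θ * (t : ℝ)).map (bridge T) := by
    rw [Measure.map_map (measurable_bridge T)
      (measurable_pi_lambda _ fun t ↦ (hX t).sub_const _)]
    congr 1
    funext ω
    exact (bridge_sub_mul T (X · ω) θ).symm
  have hbridge : (Ppos.map fun ω ↦ bridge T (X · ω)) = Pneg.map fun ω ↦ bridge T (X · ω) := by
    rw [hlaw hpos, hlaw hneg, hpos.brownian.map_eq_map hneg.brownian.toIsPreBrownianReal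
      (fun t ↦ (hX t).sub_const _) (fun t ↦ (hX t).sub_const _)]
  have := Measure.isProbabilityMeasure_map (μ := Pneg) hbr.aemeasurable
  rw [← Measure.map_apply hZ hE, hpos.map_bridge_prod, hbridge, one_mul,
    ← gaussianReal_withDensity_exp, prod_withDensity_right (by fun_prop), ← neg_one_mul (T : ℝ),
    ← hneg.map_bridge_prod, withDensity_apply _ hE,
    setLIntegral_map hE (by fun_prop) hZ]

theorem measurableSet_observed_Ioi {Ω : Type*} (X : ℝ≥0 → Ω → ℝ) (T : ℝ≥0) (c : ℝ) :
    MeasurableSet[observed X T] {ω | c < X T ω} :=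
  (le_iSup₂_of_le (f := fun j (_ : j ≤ T) ↦ MeasurableSpace.comap (X j) inferInstance) T le_rfl
    le_rfl : MeasurableSpace.comap (X T) inferInstance ≤ observed X T) _
      ⟨Ioi c, measurableSet_Ioi, rfl⟩

/-- **Neyman–Pearson lemma**: a test which accepts `θ = 1` if `X T > c` is the most powerful one at
its level. -/
theorem measure_le_of_measure_le {Pneg Ppos : Measure Ω} (hneg : IsBrownianWithDrift X (-1) Pneg)
    (hpos : IsBrownianWithDrift X 1 Ppos) {T : ℝ≥0} {A : Set Ω}
    (hA : MeasurableSet[observed X T] A) {c : ℝ} (h : Pneg A ≤ Pneg {ω | c < X T ω}) :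
    Ppos A ≤ Ppos {ω | c < X T ω} := by
  have := hneg.isProbabilityMeasure
  have hR := measurableSet_observed_Ioi X T c
  set R := {ω | c < X T ω} with hRdef
  have hle := observed_le hpos.measurable T
  have hAR : Pneg (A \ R) ≤ Pneg (R \ A) := by
    rw [← measure_inter_add_sdiff A (hle _ hR), ← measure_inter_add_sdiff R (hle _ hA),
      inter_comm R A] at h
    exact (ENNReal.add_le_add_iff_left (measure_ne_top _ _)).1 h
  have h1 : Ppos (A \ R) ≤ ENNReal.ofReal (Real.exp (2 * c)) * Pneg (A \ R) := by
    rw [measure_eq_lintegral_exp hneg hpos (hA.diff hR), ← setLIntegral_const]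
    refine setLIntegral_mono' ((hle _ hA).diff (hle _ hR)) fun ω hω ↦ ?_
    have : X T ω ≤ c := not_lt.1 (show ¬ c < X T ω from hω.2)
    gcongr
  have h2 : ENNReal.ofReal (Real.exp (2 * c)) * Pneg (R \ A) ≤ Ppos (R \ A) := by
    rw [measure_eq_lintegral_exp hneg hpos (hR.diff hA), ← setLIntegral_const]
    refine setLIntegral_mono' ((hle _ hR).diff (hle _ hA)) fun ω hω ↦ ?_
    have : c < X T ω := hω.1
    gcongr
  rw [← measure_inter_add_sdiff A (hle _ hR), ← measure_inter_add_sdiff R (hle _ hA),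
    inter_comm R A]
  exact add_le_add_right (h1.trans (le_trans (by gcongr) h2)) _

theorem IsBrownianWithDrift.measure_le (h : IsBrownianWithDrift X θ P) {T : ℝ≥0} (hT : T ≠ 0)
    (c : ℝ) : P {ω | X T ω ≤ c} = ENNReal.ofReal (Phi ((c - θ * T) / √T)) := by
  rw [← gaussianReal_Iic_eq_ofReal_Phi _ hT, ← (h.hasLaw_eval T).map_eq,
    Measure.map_apply (h.measurable T) measurableSet_Iic]
  rfl

theorem IsBrownianWithDrift.measure_gt (h : IsBrownianWithDrift X θ P) {T : ℝ≥0} (hT : T ≠ 0)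
    (c : ℝ) : P {ω | c < X T ω} = ENNReal.ofReal (Phi ((θ * T - c) / √T)) := by
  have := h.isProbabilityMeasure
  have e : {ω | c < X T ω} = {ω | X T ω ≤ c}ᶜ := by ext; simp
  rw [e, prob_compl_eq_one_sub (measurableSet_le (h.measurable T) measurable_const),
    h.measure_le hT, ← neg_sub, neg_div, Phi_neg, ENNReal.ofReal_sub _ (Phi_pos _).le,
    ENNReal.ofReal_one,
    ENNReal.sub_sub_cancel ENNReal.one_ne_top (ENNReal.ofReal_le_one.2 (Phi_lt_one _).le)]

/-- The optimal test rejects `θ = -1` if `X T > c`. At the level `α` its second error probability is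
`Φ (-Φ⁻¹ α - 2 √T)`, which is at most `β` if and only if `T` is at least the stated value. -/
theorem isLeast_fixedSampleSizes {Pneg Ppos : Measure Ω} (hneg : IsBrownianWithDrift X (-1) Pneg)
    (hpos : IsBrownianWithDrift X 1 Ppos) {α β : ℝ} (hα : α ∈ Ioo (0 : ℝ) (1 / 2))
    (hβ : β ∈ Ioo (0 : ℝ) (1 / 2)) :
    IsLeast (fixedSampleSizes X Pneg Ppos α β) ((PhiInv α + PhiInv β) ^ 2 / 4).toNNReal := by
  have hα1 : α ∈ Ioo (0 : ℝ) 1 := ⟨hα.1, by linarith [hα.2]⟩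
  have hβ1 : β ∈ Ioo (0 : ℝ) 1 := ⟨hβ.1, by linarith [hβ.2]⟩
  have hqα := PhiInv_neg hα
  have hqβ := PhiInv_neg hβ
  constructor
  · set T := ((PhiInv α + PhiInv β) ^ 2 / 4).toNNReal with hTdef
    have hTr : (T : ℝ) = (PhiInv α + PhiInv β) ^ 2 / 4 := Real.coe_toNNReal _ (by positivity)
    have hT : T ≠ 0 := by
      rw [← NNReal.coe_ne_zero, hTr]
      have : PhiInv α + PhiInv β ≠ 0 := by linarith
      positivity
    obtain ⟨r, hr⟩ : ∃ r : ℝ, r = -(PhiInv α + PhiInv β) / 2 := ⟨_, rfl⟩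
    have hr0 : 0 < r := by linarith
    have hTr2 : (T : ℝ) = r ^ 2 := by rw [hTr, hr]; ring
    have hsqrt : √(T : ℝ) = r := by rw [hTr2, Real.sqrt_sq hr0.le]
    -- the threshold for which the error probability under `θ = -1` is exactly `α`
    set c := -PhiInv α * r - r ^ 2 with hc
    classical
    have hR := measurableSet_observed_Ioi X T c
    refine ⟨fun ω ↦ if c < X T ω then 1 else -1, ?_, fun ω ↦ ?_, ?_, ?_⟩
    · exact Measurable.ite hR measurable_const measurable_const
    · by_cases h : c < X T ω <;> simp [h]
    · have e : {ω | (if c < X T ω then (1 : ℤ) else -1) = 1} = {ω | c < X T ω} := by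
        ext ω; by_cases h : c < X T ω <;> simp [h]
      rw [e, hneg.measure_gt hT, hsqrt, hTr2,
        show (-1 * r ^ 2 - c) / r = PhiInv α by rw [hc]; field_simp; ring, Phi_PhiInv hα1]
    · have e : {ω | (if c < X T ω then (1 : ℤ) else -1) = -1} = {ω | X T ω ≤ c} := by
        ext ω; by_cases h : c < X T ω <;> simp [h, not_lt.1, not_le.2]
      rw [e, hpos.measure_le hT, hsqrt, hTr2,
        show (c - 1 * r ^ 2) / r = PhiInv β by
          rw [hc, show PhiInv β = -2 * r - PhiInv α by linarith]; field_simp; ring,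
        Phi_PhiInv hβ1]
  · rintro T ⟨d, hd⟩
    have := hneg.isProbabilityMeasure
    have := hpos.isProbabilityMeasure
    have hA : MeasurableSet[observed X T] {ω | d ω = 1} := hd.measurable (measurableSet_singleton 1)
    have hcompl : {ω | d ω = -1} = {ω | d ω = 1}ᶜ := by
      ext ω
      rcases hd.values ω with h | h <;> simp [h]
    have hsum : 1 ≤ Ppos {ω | d ω = 1} + ENNReal.ofReal β := by
      rw [← prob_add_prob_compl (μ := Ppos) (observed_le hpos.measurable T _ hA), ← hcompl]
      gcongr
      exact hd.error_pos
    rw [Real.toNNReal_le_iff_le_coe]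
    rcases eq_or_ne T 0 with rfl | hT
    · -- without observation both measures agree on the test, so that its errors sum up to `1`
      have h0 : ∀ᵐ ω ∂Pneg, X 0 ω = 0 := by simpa using hneg.brownian.eval_zero_ae_eq_zero
      have heq : Ppos {ω | d ω = 1} = Pneg {ω | d ω = 1} := by
        rw [measure_eq_lintegral_exp hneg hpos hA, ← setLIntegral_one]
        refine lintegral_congr_ae (ae_restrict_of_ae ?_)
        filter_upwards [h0] with ω hω
        simp [hω]
      have h1 : (1 : ℝ≥0∞) ≤ ENNReal.ofReal α + ENNReal.ofReal β := by
        refine hsum.trans ?_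
        rw [heq]
        gcongr
        exact hd.error_neg
      rw [← ENNReal.ofReal_add hα.1.le hβ.1.le, ENNReal.one_le_ofReal] at h1
      linarith [hα.2, hβ.2]
    · have hr0 : 0 < √(T : ℝ) := Real.sqrt_pos.2 (by positivity)
      obtain ⟨r, hr⟩ : ∃ r : ℝ, r = √(T : ℝ) := ⟨_, rfl⟩
      have hTr : (T : ℝ) = r ^ 2 := by rw [hr, Real.sq_sqrt (NNReal.coe_nonneg T)]
      rw [← hr] at hr0
      set c := -PhiInv α * r - r ^ 2 with hc
      have h1 : Pneg {ω | d ω = 1} ≤ Pneg {ω | c < X T ω} := by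
        rw [hneg.measure_gt hT, ← hr, hTr,
          show (-1 * r ^ 2 - c) / r = PhiInv α by rw [hc]; field_simp; ring, Phi_PhiInv hα1]
        exact hd.error_neg
      have h2 := measure_le_of_measure_le hneg hpos hA h1
      rw [hpos.measure_gt hT, ← hr, hTr,
        show (1 * r ^ 2 - c) / r = 2 * r + PhiInv α by rw [hc]; field_simp; ring] at h2
      have h3 : (1 : ℝ≥0∞) ≤ ENNReal.ofReal (Phi (2 * r + PhiInv α)) + ENNReal.ofReal β :=
        hsum.trans (by gcongr)
      rw [← ENNReal.ofReal_add (Phi_pos _).le hβ.1.le, ENNReal.one_le_ofReal] at h3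
      have h4 : Phi (-PhiInv β) ≤ Phi (2 * r + PhiInv α) := by
        rw [Phi_neg, Phi_PhiInv hβ1]
        linarith
      rw [strictMono_Phi.le_iff_le] at h4
      rw [hTr]
      nlinarith
end drift

end SPRT

theorem theorem2 {Ω : Type*} [MeasurableSpace Ω] (X : ℝ≥0 → Ω → ℝ) (Pneg Ppos : Measure Ω)
    (hneg : SPRT.IsBrownianWithDrift X (-1) Pneg) (hpos : SPRT.IsBrownianWithDrift X 1 Ppos)
    (α β : ℝ) (hα : α ∈ Set.Ioo (0 : ℝ) (1 / 2)) (hβ : β ∈ Set.Ioo (0 : ℝ) (1 / 2)) :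
    -- the minimal fixed sample size is attained, and has the stated value
    IsLeast (SPRT.fixedSampleSizes X Pneg Ppos α β) (SPRT.minFixedSampleSize X Pneg Ppos α β) ∧
    (SPRT.minFixedSampleSize X Pneg Ppos α β : ℝ) = (SPRT.PhiInv α + SPRT.PhiInv β) ^ 2 / 4 ∧
    -- the expected sample sizes of the sequential test are finite
    SPRT.sprtMean X Pneg α β < ∞ ∧ SPRT.sprtMean X Ppos α β < ∞ ∧
    -- the explicit form of the symmetric relative efficiency
    SPRT.symmRelEff X Pneg Ppos (min α β) =
      (1 - 2 * min α β) / 2 * Real.log ((1 - min α β) / min α β) /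
        SPRT.PhiInv (min α β) ^ 2 ∧
    -- the comparison with the symmetric case, and its consequences
    SPRT.symmRelEff X Pneg Ppos (min α β) ≤ SPRT.relEff X Pneg Ppos α β ∧
    1 / 4 ≤ SPRT.relEff X Pneg Ppos α β ∧
    1 - SPRT.relEff X Pneg Ppos α β ≤ 3 / 4 := by
  open SPRT in
  have hleast {γ δ : ℝ} (hγ : γ ∈ Set.Ioo (0 : ℝ) (1 / 2)) (hδ : δ ∈ Set.Ioo (0 : ℝ) (1 / 2)) :
      IsLeast (fixedSampleSizes X Pneg Ppos γ δ) (minFixedSampleSize X Pneg Ppos γ δ) ∧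
        (minFixedSampleSize X Pneg Ppos γ δ : ℝ) = (PhiInv γ + PhiInv δ) ^ 2 / 4 := by
    have h := isLeast_fixedSampleSizes hneg hpos hγ hδ
    have e : minFixedSampleSize X Pneg Ppos γ δ = _ := h.csInf_eq
    rw [e]
    exact ⟨h, Real.coe_toNNReal _ (by positivity)⟩
  have hmin : min α β ∈ Set.Ioo (0 : ℝ) (1 / 2) := by
    rcases min_choice α β with h | h <;> rw [h] <;> assumption
  have hsymm : symmRelEff X Pneg Ppos (min α β) =
      exitMean (min α β) (min α β) / PhiInv (min α β) ^ 2 := by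
    have h0 : 0 ≤ exitMean (min α β) (min α β) := exitMean_nonneg hmin hmin
    rw [symmRelEff, sprtMean_of_drift_one hpos hmin hmin, ENNReal.toReal_ofReal h0,
      (hleast hmin hmin).2]
    congr 1
    ring
  have hcomp : symmRelEff X Pneg Ppos (min α β) ≤ relEff X Pneg Ppos α β := by
    rw [hsymm, relEff, sprtMean_of_drift_one hpos hα hβ, sprtMean_of_drift_neg_one hneg hα hβ,
      ENNReal.toReal_ofReal (exitMean_nonneg hα hβ), ENNReal.toReal_ofReal (exitMean_nonneg hβ hα),
      (hleast hα hβ).2]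
    rcases le_total α β with h | h
    · rw [min_eq_left h]
      refine (exitMean_self_div_le hα hβ h).trans ?_
      gcongr
      exact le_max_right _ _
    · rw [min_eq_right h]
      refine (exitMean_self_div_le hβ hα h).trans ?_
      rw [add_comm (PhiInv β)]
      gcongr
      exact le_max_left _ _
  have hquarter : 1 / 4 ≤ relEff X Pneg Ppos α β :=
    (quarter_le_exitMean_div hmin).trans (hsymm.symm.le.trans hcomp)
  refine ⟨(hleast hα hβ).1, (hleast hα hβ).2, ?_, ?_, ?_, hcomp, hquarter, by linarith⟩
  · rw [sprtMean_of_drift_neg_one hneg hα hβ]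
    exact ENNReal.ofReal_lt_top
  · rw [sprtMean_of_drift_one hpos hα hβ]
    exact ENNReal.ofReal_lt_top
  · rw [hsymm, exitMean_self_eq]
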